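/- **Theorem (unknown-mean Gaussian case).** Let $V$ and $U$ be non-zero finite-dimensional real Euclidean spaces, $p=\dim V$, $q=\dim U$. Write $\mathcal P(V)$ for the set of positive definite self-adjoint operators on $V$, give $V\otimes U$ its induced scalar product, and let $$\mathcal M_{\mathcal N}=\{P\otimes Q : P\in\mathcal P(V),\ Q\in\mathcal P(U)\}\subset \mathcal P(V\otimes U)$$ with the subspace topology, and $S=(V\otimes U)\times\mathcal M_{\mathcal N}$. Let $X=(X_1,\dots,X_n)$ be random vectors in $V\otimes U$, not necessarily independent or identically distributed, whose joint distribution on $(V\otimes U)^n$ is absolutely continuous with respect to Lebesgue measure, and suppose $$n>1+\frac pq+\frac qp .$$ For $(M,\Theta)\in S$ let $$f_{\mathcal N}(M,\Theta;X)=\frac1n\sum_{i=1}^n\bigl(\Theta(X_i-M),\,X_i-M\bigr)-\ln\det\Theta ,$$ which, up to scaling and an additive constant, is the Gaussian negative log-likelihood with mean $M$ and inverse covariance $\Theta=P\otimes Q$. Then, almost surely: 1. the extension of $f_{\mathcal N}(\cdot\,;X)$ by the value $+\infty$ at the point at infinity is a continuous function from the one-point compactification $S\sqcup\{\infty\}$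 to $[-\infty,+\infty]$; 2. $f_{\mathcal N}(\cdot\,;X)$ has a unique minimizer over $S$, i.e. there is exactly one $(\widehat M,\widehat\Theta)\in S$ with $f_{\mathcal N}(\widehat M,\widehat\Theta;X)\le f_{\mathcal N}(M,\Theta;X)$ for all $(M,\Theta)\in S$. -/

import Mathlib

open MeasureTheory
open scoped TensorProduct

noncomputable section

section KroneckerLikelihood

variable {V U : Type*}
  [NormedAddCommGroup V] [InnerProductSpace ℝ V]
  [NormedAddCommGroup U] [InnerProductSpace ℝ U]

/-- The open cone `𝒫(V)` of positive definite (in particular self-adjoint) operators on a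
real Euclidean space. -/
def posDefOperators (V : Type*) [NormedAddCommGroup V] [InnerProductSpace ℝ V] :
    Set (V →L[ℝ] V) :=
  {T | (T : V →ₗ[ℝ] V).IsSymmetric ∧ ∀ v : V, v ≠ 0 → 0 < inner ℝ (T v) v}

/-- The set `ℳ_𝒩` of all Kronecker products `P ⊗ Q` of positive definite operators `P` on `V` and
`Q` on `U`, as a subset of the space of operators on `V ⊗ U` (from which, as a subtype, it takes
its topology). -/
def kroneckerCone (V U : Type*)
    [NormedAddCommGroup V] [InnerProductSpace ℝ V]
    [NormedAddCommGroup U] [InnerProductSpace ℝ U] :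
    Set (V ⊗[ℝ] U →L[ℝ] V ⊗[ℝ] U) :=
  {T | ∃ P ∈ posDefOperators V, ∃ Q ∈ posDefOperators U, T = TensorProduct.mapL P Q}

/-- The Gaussian negative log-likelihood (up to additive constant and scaling) with unknown mean `M`
and inverse covariance `Θ = P ⊗ Q`, as a function on `S = (V ⊗ U) × ℳ_𝒩`:
`f(M, Θ; x) = (1/n) ∑ᵢ ⟪Θ (xᵢ - M), xᵢ - M⟫ - ln det Θ`.
With `V ⊗ U` identified with matrices, `⟪(P ⊗ Q) Y, Y⟫ = Tr (P Y Q Yᵀ)`. -/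
def gaussianNLL {n : ℕ} (x : Fin n → V ⊗[ℝ] U)
    (s : (V ⊗[ℝ] U) × kroneckerCone V U) : ℝ :=
  (1 / (n : ℝ)) * ∑ i, inner ℝ ((s.2 : V ⊗[ℝ] U →L[ℝ] V ⊗[ℝ] U) (x i - s.1)) (x i - s.1)
    - Real.log (s.2 : V ⊗[ℝ] U →L[ℝ] V ⊗[ℝ] U).det

end KroneckerLikelihood

/-- The extension of a real function on `S` to the one-point compactification of `S`, with values
in the two-point compactification of `ℝ`, by the value `+∞` at the point at infinity. -/
def extendByTop {S : Type*} (f : S → ℝ) (z : OnePoint S) : EReal :=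
  z.elim ⊤ fun s => (f s : EReal)

/-- A finite family of random vectors in a Euclidean space `E` is jointly (mutually) continuous:
its joint law on `Eⁿ` is absolutely continuous with respect to Lebesgue measure. -/
def JointlyContinuous {Ω E : Type*} [MeasurableSpace Ω] [NormedAddCommGroup E]
    [InnerProductSpace ℝ E] [FiniteDimensional ℝ E] [MeasurableSpace E] [BorelSpace E]
    {n : ℕ} (X : Fin n → Ω → E) (μ : Measure Ω) : Prop :=
  AEMeasurable (fun ω i => X i ω) μ ∧
    μ.map (fun ω i => X i ω) ≪ (volume : Measure (Fin n → E))

end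

/-!
Let `p = dim V` and `q = dim U`. Call a tuple `y` of tensors stable if every nonzero `W ⊗ Z`
orthogonal to all of `y` satisfies `dim W / p + dim Z / q < 1`.

Minimizing over the mean first replaces `M` by the sample mean, at the cost of a positive definite
quadratic form in `M - x̄`. If the factors of `Θ = P ⊗ Q` have eigenvalues `exp aᵢ` and `exp bⱼ`,
the remaining function is `∑ (cᵢⱼ exp (aᵢ + bⱼ) - (aᵢ + bⱼ))`, where `cᵢⱼ` is the second moment of
the sample in the direction of the `(i, j)`-th pair of eigenvectors. For stable deviations from the
mean the pattern of positive `cᵢⱼ` satisfies a strict Hall condition. By the marriage theorem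
`∑ (aᵢ + bⱼ)` is then one arbitrary exponent plus exponents in cells with `cᵢⱼ > 0`, so the
exponential terms control every exponent. As the orthonormal frames form a compact set, this is
uniform in the eigenbases, and the sublevel sets are compact. For uniqueness, bring two minimizers
simultaneously to the form above with all exponents of the first equal to `0`; strict convexity
along the geodesic joining them forces `aᵢ + bⱼ = 0` wherever `cᵢⱼ > 0`, hence everywhere.

The deviations from the mean are stable as soon as the `n - 1` differences `xₖ₊₁ - x₀` are. The
tuples of `n - 1` tensors orthogonal to some `W ⊗ Z` with `dim W = r` and `dim Z = s` are covered by
finitely many smooth charts of dimension `(p - r) r + (q - s) s + (n - 1) (p q - r s)`. If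
`r / p + s / q ≥ 1`, then `(p - r) / s ≤ p / q` and `(q - s) / r ≤ q / p`, so this dimension is less
than `(n - 1) p q` because `n - 1 > p / q + q / p`.
-/

/-- A bipartite relation between `ι` and `κ` satisfies the strict (weighted) Hall condition if
every nonempty rectangle `I × J` that avoids it satisfies `|I| / |ι| + |J| / |κ| < 1`. -/
def StrictHall {ι κ : Type*} [Fintype ι] [Fintype κ] (R : ι → κ → Prop) : Prop :=
  ∀ (I : Finset ι) (J : Finset κ), I.Nonempty → J.Nonempty → (∀ i ∈ I, ∀ j ∈ J, ¬ R i j) →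
    I.card * Fintype.card κ + J.card * Fintype.card ι < Fintype.card ι * Fintype.card κ

namespace StrictHall

variable {ι κ : Type*} [Fintype ι] [Fintype κ] {R R' : ι → κ → Prop}

theorem mono (h : StrictHall R) (hRR' : ∀ i j, R i j → R' i j) : StrictHall R' :=
  fun I J hI hJ hIJ => h I J hI hJ fun i hi j hj hR => hIJ i hi j hj (hRR' i j hR)

theorem exists_right [Nonempty κ] (h : StrictHall R) (i : ι) : ∃ j, R i j := by
  by_contra! hi
  have := h {i} Finset.univ (by simp) (by simp) (by simpa using hi)
  rw [Finset.card_univ, mul_comm (Fintype.card κ)] at this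
  omega

theorem exists_left [Nonempty ι] (h : StrictHall R) (j : κ) : ∃ i, R i j := by
  by_contra! hj
  have := h Finset.univ {j} (by simp) (by simp) (by simpa using hj)
  rw [Finset.card_univ] at this
  omega

theorem card_mul_lt_of_forall_mem (h : StrictHall R) {I : Finset ι} {J : Finset κ}
    (hI : I.Nonempty) (hJ : J ≠ Finset.univ) (hIJ : ∀ i ∈ I, ∀ j, R i j → j ∈ J) :
    I.card * Fintype.card κ < Fintype.card ι * J.card := by
  classical
  have hJc : Jᶜ.Nonempty := Finset.nonempty_iff_ne_empty.2 (by simpa using hJ)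
  have hlt := h I Jᶜ hI hJc fun i hi j hj hR => Finset.mem_compl.1 hj (hIJ i hi j hR)
  have hcard : Jᶜ.card + J.card = Fintype.card κ := Finset.card_compl_add_card J
  nlinarith

-- Hall's theorem for the cells other than `x₀`, a cell `x` being joined to the cells whose column
-- is related to the row of `x`; strictness pays for the deleted cell.
theorem exists_perm (h : StrictHall R) (x₀ : ι × κ) :
    ∃ σ : Equiv.Perm {x : ι × κ // x ≠ x₀}, ∀ x, R x.1.1 (σ x).1.2 := by
  classical
  let t (x : {x : ι × κ // x ≠ x₀}) : Finset {x : ι × κ // x ≠ x₀} := {y | R x.1.1 y.1.2}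
  have hall (s : Finset {x : ι × κ // x ≠ x₀}) : s.card ≤ (s.biUnion t).card := by
    rcases s.eq_empty_or_nonempty with rfl | hs
    · simp
    let I : Finset ι := s.image fun x => x.1.1
    let J : Finset κ := {j | ∃ i ∈ I, R i j}
    have ht : s.biUnion t = Finset.univ.filter fun y => y.1.2 ∈ J := by
      ext y
      simp [t, J, I]
    by_cases hJ : J = Finset.univ
    · simpa [ht, hJ] using Finset.card_le_univ s
    have hsI : s.card ≤ I.card * Fintype.card κ := by
      rw [← Finset.card_univ (α := κ), ← Finset.card_product, ← Finset.card_map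
        (Function.Embedding.subtype _)]
      refine Finset.card_le_card fun y hy => ?_
      obtain ⟨x, hx, rfl⟩ := Finset.mem_map.1 hy
      exact Finset.mem_product.2 ⟨Finset.mem_image_of_mem _ hx, Finset.mem_univ _⟩
    have hIJ : I.card * Fintype.card κ < Fintype.card ι * J.card :=
      h.card_mul_lt_of_forall_mem (hs.image _) hJ fun i hi j hij => by simpa [J] using ⟨i, hi, hij⟩
    have hJt : Fintype.card ι * J.card - 1 ≤ (s.biUnion t).card := by
      have hmap : (s.biUnion t).map (Function.Embedding.subtype _) =
          ((Finset.univ : Finset ι) ×ˢ J).erase x₀ := by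
        ext y
        simp [ht, and_comm]
      rw [← Finset.card_map (Function.Embedding.subtype _), hmap, ← Finset.card_univ,
        ← Finset.card_product]
      exact Finset.pred_card_le_card_erase
    omega
  obtain ⟨f, hf, hft⟩ := (Finset.all_card_le_biUnion_card_iff_exists_injective t).1 hall
  exact ⟨Equiv.ofBijective f hf.bijective_of_finite, fun x => by simpa [t] using hft x⟩

theorem exists_sum_eq [DecidableEq ι] [DecidableEq κ] (h : StrictHall R) (x₀ : ι × κ)
    (a : ι → ℝ) (b : κ → ℝ) :
    ∃ σ : {x : ι × κ // x ≠ x₀} → ι × κ, (∀ x, R (σ x).1 (σ x).2) ∧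
      ∑ x : ι × κ, (a x.1 + b x.2) = a x₀.1 + b x₀.2 + ∑ x, (a (σ x).1 + b (σ x).2) := by
  obtain ⟨σ, hσ⟩ := h.exists_perm x₀
  refine ⟨fun x => (x.1.1, (σ x).1.2), hσ, ?_⟩
  rw [Fintype.sum_eq_add_sum_subtype_ne _ x₀, Finset.sum_add_distrib, Finset.sum_add_distrib,
    Equiv.sum_comp σ fun x => b x.1.2]

theorem add_eq_zero [Nonempty κ] (h : StrictHall R) {a : ι → ℝ} {b : κ → ℝ}
    (hab : ∀ i j, R i j → a i + b j = 0) (i : ι) (j : κ) : a i + b j = 0 := by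
  classical
  have hsum (x : ι × κ) : ∑ x : ι × κ, (a x.1 + b x.2) = a x.1 + b x.2 := by
    obtain ⟨σ, hσ, hs⟩ := h.exists_sum_eq x a b
    rw [hs, Finset.sum_eq_zero fun x _ => hab _ _ (hσ x), add_zero]
  obtain ⟨j', hj'⟩ := h.exists_right i
  rw [← hsum (i, j), hsum (i, j')]
  exact hab _ _ hj'

end StrictHall

theorem exists_pos_forall_strictHall_le {ι κ Z : Type*} [Fintype ι] [Fintype κ]
    [TopologicalSpace Z] {K : Set Z} (hK : IsCompact K) {c : Z → ι → κ → ℝ}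
    (hc : ∀ i j, Continuous fun z => c z i j)
    (hpos : ∀ z ∈ K, StrictHall fun i j => 0 < c z i j) :
    ∃ δ > 0, ∀ z ∈ K, StrictHall fun i j => δ ≤ c z i j := by
  refine hK.induction_on ⟨1, one_pos, by simp⟩ ?mono ?union fun z₀ hz₀ => ?nhds
  case mono =>
    rintro s t hst ⟨δ, hδ, h⟩
    exact ⟨δ, hδ, fun z hz => h z (hst hz)⟩
  case union =>
    rintro s t ⟨δ, hδ, hs⟩ ⟨ε, hε, ht⟩
    refine ⟨min δ ε, lt_min hδ hε, fun z hz => ?_⟩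
    rcases hz with hz | hz
    · exact (hs z hz).mono fun i j hij => (min_le_left _ _).trans hij
    · exact (ht z hz).mono fun i j hij => (min_le_right _ _).trans hij
  case nhds =>
    have hsmall : ∀ᶠ δ in nhdsWithin (0 : ℝ) (Set.Ioi 0), ∀ i j, 0 < c z₀ i j → δ < c z₀ i j :=
      Filter.eventually_all.2 fun i => Filter.eventually_all.2 fun j => by
        by_cases hij : 0 < c z₀ i j
        · filter_upwards [nhdsWithin_le_nhds (Iio_mem_nhds hij)] with δ hδ _ using hδ
        · exact Filter.Eventually.of_forall fun _ h => absurd h hij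
    obtain ⟨δ, hδ, hδ0⟩ := (hsmall.and self_mem_nhdsWithin).exists
    refine ⟨{z | ∀ i j, 0 < c z₀ i j → δ < c z i j}, mem_nhdsWithin_of_mem_nhds ?_, δ, hδ0,
      fun z hz => (hpos z₀ hz₀).mono fun i j hij => (hz i j hij).le⟩
    refine Filter.eventually_all.2 fun i => Filter.eventually_all.2 fun j => ?_
    by_cases hij : 0 < c z₀ i j
    · filter_upwards [(hc i j).continuousAt.eventually (Ioi_mem_nhds (hδ i j hij))]
        with z hz _ using hz
    · exact Filter.Eventually.of_forall fun _ h => absurd h hij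

theorem one_add_log_le_mul_exp_sub {η : ℝ} (hη : 0 < η) (t : ℝ) :
    1 + Real.log η ≤ η * Real.exp t - t := by
  have := Real.add_one_le_exp (t + Real.log η)
  rw [Real.exp_add, Real.exp_log hη] at this
  linarith

section SeparableEnergy

variable {ι κ : Type*} [Fintype ι] [Fintype κ]

/-- The Gaussian negative log-likelihood of a Kronecker product in terms of the logarithms `a i`
and `b j` of the eigenvalues of the two factors; the coefficients `c i j` are the mean squared
coordinates of the sample in the product of the two eigenbases. -/
noncomputable def separableEnergy (c : ι → κ → ℝ) (a : ι → ℝ) (b : κ → ℝ) : ℝ :=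
  ∑ x : ι × κ, (c x.1 x.2 * Real.exp (a x.1 + b x.2) - (a x.1 + b x.2))

-- The sum of all exponents is one arbitrary exponent plus exponents of cells with `δ ≤ c`, each of
-- which is controlled by the exponential sum through `one_add_log_le_mul_exp_sub`.
theorem le_separableEnergy_of_strictHall {c : ι → κ → ℝ} (hc : ∀ i j, 0 ≤ c i j) {δ : ℝ}
    (hδ : 0 < δ) (h : StrictHall fun i j => δ ≤ c i j) (a : ι → ℝ) (b : κ → ℝ) (x y : ι × κ)
    (hy : δ ≤ c y.1 y.2) :
    (Fintype.card (ι × κ) - 1) * (1 + Real.log (δ / Fintype.card (ι × κ))) +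
        (δ / Fintype.card (ι × κ) * Real.exp (a y.1 + b y.2) - (a x.1 + b x.2)) ≤
      separableEnergy c a b := by
  classical
  set N : ℕ := Fintype.card (ι × κ) with hN
  have hN0 : 0 < N := Fintype.card_pos_iff.2 ⟨x⟩
  have hη : 0 < δ / N := by positivity
  set S : ℝ := ∑ x : ι × κ, c x.1 x.2 * Real.exp (a x.1 + b x.2)
  have hcell (z : ι × κ) (hz : δ ≤ c z.1 z.2) :
      δ / N * Real.exp (a z.1 + b z.2) ≤ S / N := by
    rw [div_mul_eq_mul_div]
    gcongr
    calc δ * Real.exp (a z.1 + b z.2) ≤ c z.1 z.2 * Real.exp (a z.1 + b z.2) := by gcongr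
      _ ≤ S := Finset.single_le_sum (f := fun x : ι × κ => c x.1 x.2 * Real.exp (a x.1 + b x.2))
        (fun x _ => mul_nonneg (hc _ _) (Real.exp_pos _).le) (Finset.mem_univ z)
  obtain ⟨σ, hσ, hsum⟩ := h.exists_sum_eq x a b
  have hσ_le : ∑ z, (a (σ z).1 + b (σ z).2) ≤ (N - 1) * (S / N - (1 + Real.log (δ / N))) := by
    refine (Finset.sum_le_card_nsmul _ _ (S / N - (1 + Real.log (δ / N))) fun z _ => ?_).trans_eq ?_
    · linarith [hcell (σ z) (hσ z), one_add_log_le_mul_exp_sub hη (a (σ z).1 + b (σ z).2)]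
    · rw [Finset.card_univ, Fintype.card_subtype_compl, Fintype.card_subtype_eq, nsmul_eq_mul,
        ← hN, Nat.cast_sub hN0, Nat.cast_one]
  have hS : S = (N - 1) * (S / N) + S / N := by field_simp; ring
  rw [separableEnergy, Finset.sum_sub_distrib, hsum]
  linarith [hcell y hy]

theorem separableEnergy_zero_add_separableEnergy_sub (c : ι → κ → ℝ) (a : ι → ℝ) (b : κ → ℝ) :
    separableEnergy c 0 0 + separableEnergy c a b -
        2 * separableEnergy c (fun i => a i / 2) (fun j => b j / 2) =
      ∑ x : ι × κ, c x.1 x.2 * (1 - Real.exp (a x.1 / 2 + b x.2 / 2)) ^ 2 := by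
  simp only [separableEnergy, Finset.mul_sum, ← Finset.sum_add_distrib, ← Finset.sum_sub_distrib]
  refine Finset.sum_congr rfl fun x _ => ?_
  have hexp : Real.exp (a x.1 + b x.2) = Real.exp (a x.1 / 2 + b x.2 / 2) ^ 2 := by
    rw [← Real.exp_nat_mul]
    ring_nf
  simp only [hexp, Pi.zero_apply, add_zero, Real.exp_zero]
  ring

theorem add_eq_zero_of_separableEnergy_le [Nonempty κ] {c : ι → κ → ℝ} (hc : ∀ i j, 0 ≤ c i j)
    (h : StrictHall fun i j => 0 < c i j)
    (hmin : ∀ a b, separableEnergy c 0 0 ≤ separableEnergy c a b) {a : ι → ℝ} {b : κ → ℝ}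
    (hab : separableEnergy c a b ≤ separableEnergy c 0 0) (i : ι) (j : κ) : a i + b j = 0 := by
  have hterm (x : ι × κ) : 0 ≤ c x.1 x.2 * (1 - Real.exp (a x.1 / 2 + b x.2 / 2)) ^ 2 :=
    mul_nonneg (hc _ _) (sq_nonneg _)
  have hsum : ∑ x : ι × κ, c x.1 x.2 * (1 - Real.exp (a x.1 / 2 + b x.2 / 2)) ^ 2 = 0 :=
    le_antisymm (by linarith [hmin (fun i => a i / 2) (fun j => b j / 2),
      separableEnergy_zero_add_separableEnergy_sub c a b])
      (Finset.sum_nonneg fun x _ => hterm x)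
  refine h.add_eq_zero (fun i j hij => ?_) i j
  have hzero := (Finset.sum_eq_zero_iff_of_nonneg fun x _ => hterm x).1 hsum (i, j)
    (Finset.mem_univ _)
  have hexp : Real.exp (a i / 2 + b j / 2) = 1 :=
    (sub_eq_zero.1 (pow_eq_zero_iff two_ne_zero |>.1
      ((mul_eq_zero.1 hzero).resolve_left hij.ne'))).symm
  linarith [(Real.exp_eq_one_iff _).1 hexp]

variable [Nonempty ι] [Nonempty κ]

theorem card_mul_le_separableEnergy_of_strictHall {c : ι → κ → ℝ} (hc : ∀ i j, 0 ≤ c i j) {δ : ℝ}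
    (hδ : 0 < δ) (h : StrictHall fun i j => δ ≤ c i j) (a : ι → ℝ) (b : κ → ℝ) :
    Fintype.card (ι × κ) * (1 + Real.log (δ / Fintype.card (ι × κ))) ≤ separableEnergy c a b := by
  obtain ⟨i⟩ := ‹Nonempty ι›
  obtain ⟨j, hj⟩ := h.exists_right i
  have hη : 0 < δ / Fintype.card (ι × κ) := by positivity
  linarith [le_separableEnergy_of_strictHall hc hδ h a b (i, j) (i, j) hj,
    one_add_log_le_mul_exp_sub hη (a i + b j)]

variable (ι κ) in
theorem exists_forall_abs_add_le_of_separableEnergy_le {δ : ℝ} (hδ : 0 < δ) (A : ℝ) :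
    ∃ C : ℝ, ∀ c : ι → κ → ℝ, (∀ i j, 0 ≤ c i j) → StrictHall (fun i j => δ ≤ c i j) →
      ∀ (a : ι → ℝ) (b : κ → ℝ), separableEnergy c a b ≤ A → ∀ i j, |a i + b j| ≤ C := by
  set η : ℝ := δ / Fintype.card (ι × κ)
  have hη : 0 < η := by positivity
  set B : ℝ := A - (Fintype.card (ι × κ) - 1) * (1 + Real.log η)
  set D : ℝ := B - 2 * (1 + Real.log (η / 2))
  refine ⟨2 * |B| + 2 * |D|, fun c hc h a b hA => ?_⟩
  have lower (i j) : -B ≤ a i + b j := by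
    obtain ⟨j', hj'⟩ := h.exists_right i
    have hexp : 0 ≤ η * Real.exp (a i + b j') := by positivity
    linarith [le_separableEnergy_of_strictHall hc hδ h a b (i, j) (i, j') hj']
  have upper (i j) (hij : δ ≤ c i j) : a i + b j ≤ D := by
    linarith [le_separableEnergy_of_strictHall hc hδ h a b (i, j) (i, j) hij,
      one_add_log_le_mul_exp_sub (half_pos hη) (a i + b j)]
  intro i j
  obtain ⟨j', hj'⟩ := h.exists_right i
  obtain ⟨i', hi'⟩ := h.exists_left j
  have hexchange : a i + b j = (a i + b j') + (a i' + b j) - (a i' + b j') := by ring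
  rw [hexchange, abs_le]
  constructor <;> linarith [lower i j, lower i' j', upper i j' hj', upper i' j hi', le_abs_self B,
    le_abs_self D, abs_nonneg B, abs_nonneg D]

theorem exists_norm_le_of_abs_add_le {a : ι → ℝ} {b : κ → ℝ} {C : ℝ}
    (h : ∀ i j, |a i + b j| ≤ C) :
    ∃ (a' : ι → ℝ) (b' : κ → ℝ), (∀ i j, a' i + b' j = a i + b j) ∧ ‖(a', b')‖ ≤ 2 * C := by
  obtain ⟨i₀⟩ := ‹Nonempty ι›
  obtain ⟨j₀⟩ := ‹Nonempty κ›
  have hC : 0 ≤ C := (abs_nonneg _).trans (h i₀ j₀)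
  refine ⟨fun i => a i - a i₀, fun j => a i₀ + b j, fun i j => by ring, ?_⟩
  simp only [norm_prod_le_iff, pi_norm_le_iff_of_nonneg (by positivity : 0 ≤ 2 * C),
    Real.norm_eq_abs]
  refine ⟨fun i => ?_, fun j => (h i₀ j).trans (by linarith)⟩
  calc |a i - a i₀| = |(a i + b j₀) - (a i₀ + b j₀)| := by ring_nf
    _ ≤ |a i + b j₀| + |a i₀ + b j₀| := abs_sub _ _
    _ ≤ 2 * C := by linarith [h i j₀, h i₀ j₀]

end SeparableEnergy

section NullRange

variable {D F : Type*} [NormedAddCommGroup D] [NormedSpace ℝ D] [FiniteDimensional ℝ D]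
  [NormedAddCommGroup F] [NormedSpace ℝ F] [FiniteDimensional ℝ F] [MeasurableSpace F]
  [BorelSpace F]

theorem addHaar_eq_zero_of_dimH_lt_finrank (μ : Measure F) [μ.IsAddHaarMeasure] {s : Set F}
    (hs : dimH s < Module.finrank ℝ F) : μ s = 0 := by
  refine measure_zero_of_dimH_lt (d := Module.finrank ℝ F) ?_ (by exact_mod_cast hs)
  rw [NNReal.coe_natCast, Measure.isAddLeftInvariant_eq_smul μ
    (Measure.hausdorffMeasure (Module.finrank ℝ F) : Measure F)]
  exact Measure.smul_absolutelyContinuous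

theorem addHaar_range_eq_zero_of_contDiff (μ : Measure F) [μ.IsAddHaarMeasure] {g : D → F}
    (hg : ContDiff ℝ 1 g) (hDF : Module.finrank ℝ D < Module.finrank ℝ F) :
    μ (Set.range g) = 0 :=
  addHaar_eq_zero_of_dimH_lt_finrank μ (hg.dimH_range_le.trans_lt (by exact_mod_cast hDF))

end NullRange

theorem exists_isCompl_span_image {𝕜 M ι : Type*} [DivisionRing 𝕜] [AddCommGroup M] [Module 𝕜 M]
    {v : ι → M} (hv : Submodule.span 𝕜 (Set.range v) = ⊤) (W : Submodule 𝕜 M) :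
    ∃ s : Set ι, IsCompl (Submodule.span 𝕜 (v '' s)) W := by
  obtain ⟨s, -, -, hspan, hs⟩ := exists_linearIndepOn_extension
    (linearIndepOn_empty 𝕜 (W.mkQ ∘ v)) (Set.subset_univ ∅)
  refine ⟨s, ?disjoint, ?codisjoint⟩
  case disjoint =>
    have := Submodule.range_ker_disjoint (f := W.mkQ) (v := fun i : s => v i) hs
    rwa [Submodule.ker_mkQ, ← Set.image_eq_range] at this
  case codisjoint =>
    have hmap : (Submodule.span 𝕜 (v '' s)).map W.mkQ = ⊤ := by
      rw [Submodule.map_span, ← Set.image_comp, eq_top_iff, ← W.range_mkQ,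
        LinearMap.range_eq_map, ← hv, Submodule.map_span, ← Set.range_comp, ← Set.image_univ]
      exact Submodule.span_le.2 hspan
    rw [codisjoint_comm, codisjoint_iff]
    exact (Submodule.map_mkQ_eq_top _ _).1 hmap

theorem finrank_span_image_of_linearIndependent {𝕜 M ι : Type*} [DivisionRing 𝕜] [AddCommGroup M]
    [Module 𝕜 M] {v : ι → M} (hv : LinearIndependent 𝕜 v) (I : Finset ι) :
    Module.finrank 𝕜 (Submodule.span 𝕜 (v '' I)) = I.card := by
  have h := finrank_span_eq_card (hv.comp _ (Subtype.val_injective (p := (· ∈ I))))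
  rwa [Fintype.card_coe, Set.range_comp, Subtype.range_coe_subtype] at h

section Stable

variable {V U : Type*} [NormedAddCommGroup V] [InnerProductSpace ℝ V]
  [NormedAddCommGroup U] [InnerProductSpace ℝ U]

/-- The subspace `W ⊗ Z` of `V ⊗ U`. -/
noncomputable def tensorSubmodule (W : Submodule ℝ V) (Z : Submodule ℝ U) :
    Submodule ℝ (V ⊗[ℝ] U) :=
  Submodule.map₂ (TensorProduct.mk ℝ V U) W Z

theorem mem_orthogonal_tensorSubmodule_span_iff {s : Set V} {t : Set U} {y : V ⊗[ℝ] U} :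
    y ∈ (tensorSubmodule (Submodule.span ℝ s) (Submodule.span ℝ t))ᗮ ↔
      ∀ a ∈ s, ∀ b ∈ t, inner ℝ y (a ⊗ₜ[ℝ] b) = 0 := by
  have hle (T : Submodule ℝ (V ⊗[ℝ] U)) : y ∈ Tᗮ ↔ T ≤ (Submodule.span ℝ {y})ᗮ := by
    rw [T.mem_orthogonal' y]
    exact forall₂_congr fun _ _ => Submodule.mem_orthogonal_singleton_iff_inner_right.symm
  rw [hle, tensorSubmodule, Submodule.map₂_span_span, Submodule.span_le, Set.image2_subset_iff]
  simp only [TensorProduct.mk_apply, SetLike.mem_coe,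
    Submodule.mem_orthogonal_singleton_iff_inner_right]

theorem mem_orthogonal_tensorSubmodule_iff {W : Submodule ℝ V} {Z : Submodule ℝ U}
    {y : V ⊗[ℝ] U} :
    y ∈ (tensorSubmodule W Z)ᗮ ↔ ∀ a ∈ W, ∀ b ∈ Z, inner ℝ y (a ⊗ₜ[ℝ] b) = 0 := by
  simpa using mem_orthogonal_tensorSubmodule_span_iff (s := (W : Set V)) (t := (Z : Set U))

theorem finrank_tensorSubmodule (W : Submodule ℝ V) (Z : Submodule ℝ U) :
    Module.finrank ℝ (tensorSubmodule W Z) = Module.finrank ℝ W * Module.finrank ℝ Z := by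
  rw [tensorSubmodule, ← TensorProduct.range_mapIncl, LinearMap.finrank_range_of_inj
    (Module.Flat.tensorProduct_mapIncl_injective_of_left ..), Module.finrank_tensorProduct]

/-- A tuple of tensors is stable if every nonzero rectangle `W ⊗ Z` orthogonal to all of them
satisfies `dim W / dim V + dim Z / dim U < 1`. -/
def IsStableTuple {ν : Type*} (y : ν → V ⊗[ℝ] U) : Prop :=
  ∀ (W : Submodule ℝ V) (Z : Submodule ℝ U), W ≠ ⊥ → Z ≠ ⊥ →
    (∀ k, y k ∈ (tensorSubmodule W Z)ᗮ) →
    Module.finrank ℝ W * Module.finrank ℝ U + Module.finrank ℝ Z * Module.finrank ℝ V <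
      Module.finrank ℝ V * Module.finrank ℝ U

theorem IsStableTuple.strictHall {ν ι κ : Type*} [Fintype ι] [Fintype κ] {y : ν → V ⊗[ℝ] U}
    (hy : IsStableTuple y) {e : ι → V} {f : κ → U} (he : LinearIndependent ℝ e)
    (hf : LinearIndependent ℝ f) (hι : Fintype.card ι = Module.finrank ℝ V)
    (hκ : Fintype.card κ = Module.finrank ℝ U) :
    StrictHall fun i j => ∃ k, inner ℝ (y k) (e i ⊗ₜ[ℝ] f j) ≠ 0 := by
  classical
  intro I J hI hJ hIJ
  have hI' : Module.finrank ℝ (Submodule.span ℝ (e '' I)) = I.card :=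
    finrank_span_image_of_linearIndependent he I
  have hJ' : Module.finrank ℝ (Submodule.span ℝ (f '' J)) = J.card :=
    finrank_span_image_of_linearIndependent hf J
  have := hy (Submodule.span ℝ (e '' I)) (Submodule.span ℝ (f '' J))
    (fun h => hI.card_pos.ne' (by rw [← hI', h, finrank_bot]))
    (fun h => hJ.card_pos.ne' (by rw [← hJ', h, finrank_bot]))
    fun k => mem_orthogonal_tensorSubmodule_span_iff.2 <| by
      rintro _ ⟨i, hi, rfl⟩ _ ⟨j, hj, rfl⟩
      by_contra hne
      exact hIJ i hi j hj ⟨k, hne⟩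
  rwa [hI', hJ', ← hι, ← hκ] at this

theorem isBoundedBilinearMap_mapL : IsBoundedBilinearMap ℝ
    fun T : (V →L[ℝ] V) × (U →L[ℝ] U) => TensorProduct.mapL T.1 T.2 where
  add_left _ _ _ := TensorProduct.mapL_add_left _ _ _
  smul_left _ _ _ := TensorProduct.mapL_smul_left _ _ _
  add_right _ _ _ := TensorProduct.mapL_add_right _ _ _
  smul_right _ _ _ := TensorProduct.mapL_smul_right _ _ _
  bound := ⟨1, one_pos, fun P Q => by simpa using TensorProduct.norm_mapL_le P Q⟩

theorem contDiff_mapL {D : Type*} [NormedAddCommGroup D] [NormedSpace ℝ D] {n : WithTop ℕ∞}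
    {P : D → V →L[ℝ] V} {Q : D → U →L[ℝ] U} (hP : ContDiff ℝ n P) (hQ : ContDiff ℝ n Q) :
    ContDiff ℝ n fun z => TensorProduct.mapL (P z) (Q z) := by
  have hmapL : ContDiff ℝ n
      fun T : (V →L[ℝ] V) × (U →L[ℝ] U) => TensorProduct.mapL T.1 T.2 :=
    IsBoundedBilinearMap.contDiff (𝕜 := ℝ) (G := V ⊗[ℝ] U →L[ℝ] V ⊗[ℝ] U)
      isBoundedBilinearMap_mapL
  have hPQ : ContDiff ℝ n fun z => (P z, Q z) := hP.prodMk hQ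
  have hcomp := hmapL.comp hPQ
  exact hcomp

variable [FiniteDimensional ℝ V] [FiniteDimensional ℝ U]

/-- The operator that adds `E x` to the component `x ∈ K` of a vector; the adjoints of these
operators carry `Kᗮ` onto the complements of `K`. -/
noncomputable def shear (K : Submodule ℝ V) (E : K →L[ℝ] Kᗮ) : V →L[ℝ] V :=
  1 + Kᗮ.subtypeL ∘L E ∘L K.orthogonalProjectionOnto

theorem shear_mul_shear_neg (K : Submodule ℝ V) (E : K →L[ℝ] Kᗮ) :
    shear K E * shear K (-E) = 1 := by
  ext x
  have hproj (z : Kᗮ) : K.orthogonalProjectionOnto (z : V) = 0 :=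
    K.orthogonalProjectionOnto_eq_zero_iff.2 z.2
  simp [shear, hproj]

theorem exists_adjoint_shear_neg_mem {K W : Submodule ℝ V} (h : IsCompl K W) :
    ∃ E : K →L[ℝ] Kᗮ, ∀ a ∈ Kᗮ, ContinuousLinearMap.adjoint (shear K (-E)) a ∈ W := by
  let D : Kᗮ →L[ℝ] K := (K.projectionOnto W h).toContinuousLinearMap ∘L Kᗮ.subtypeL
  refine ⟨ContinuousLinearMap.adjoint D, fun a ha => ?_⟩
  have hadjoint : ContinuousLinearMap.adjoint (shear K (-ContinuousLinearMap.adjoint D)) a =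
      a - K.projection W h a := by
    have ha' : Kᗮ.orthogonalProjectionOnto a = ⟨a, ha⟩ :=
      Kᗮ.orthogonalProjectionOnto_mem_subspace_eq_self ⟨a, ha⟩
    have hone : ContinuousLinearMap.adjoint (1 : V →L[ℝ] V) = 1 := star_one _
    simp only [shear, map_add, hone, ContinuousLinearMap.adjoint_comp, Submodule.adjoint_subtypeL,
      Submodule.adjoint_orthogonalProjectionOnto, map_neg, ContinuousLinearMap.adjoint_adjoint,
      _root_.add_apply, ContinuousLinearMap.comp_apply, ha']
    simp [D, sub_eq_add_neg]
  rw [hadjoint]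
  exact Submodule.sub_projection_mem h a

/-- A parametrization of the tuples of tensors orthogonal to some `W ⊗ Z`, where `W` and `Z` are
complements of the subspaces `K` and `L`. -/
noncomputable def rectangleChart {ν : Type*} (K : Submodule ℝ V) (L : Submodule ℝ U)
    (z : (K →L[ℝ] Kᗮ) × (L →L[ℝ] Lᗮ) × (ν → (tensorSubmodule Kᗮ Lᗮ)ᗮ)) (k : ν) : V ⊗[ℝ] U :=
  TensorProduct.mapL (shear K z.1) (shear L z.2.1) (z.2.2 k : V ⊗[ℝ] U)

theorem mem_range_rectangleChart {ν : Type*} {K W : Submodule ℝ V} {L Z : Submodule ℝ U}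
    (hK : IsCompl K W) (hL : IsCompl L Z) {y : ν → V ⊗[ℝ] U}
    (hy : ∀ k, y k ∈ (tensorSubmodule W Z)ᗮ) : y ∈ Set.range (rectangleChart K L) := by
  obtain ⟨E, hE⟩ := exists_adjoint_shear_neg_mem hK
  obtain ⟨F, hF⟩ := exists_adjoint_shear_neg_mem hL
  have hmem (k) : TensorProduct.mapL (shear K (-E)) (shear L (-F)) (y k) ∈
      (tensorSubmodule Kᗮ Lᗮ)ᗮ := by
    refine mem_orthogonal_tensorSubmodule_iff.2 fun a ha b hb => ?_
    rw [← ContinuousLinearMap.adjoint_inner_right, TensorProduct.adjoint_mapL,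
      TensorProduct.mapL_tmul]
    exact mem_orthogonal_tensorSubmodule_iff.1 (hy k) _ (hE a ha) _ (hF b hb)
  refine ⟨(E, F, fun k => ⟨_, hmem k⟩), funext fun k => ?_⟩
  have hinv : TensorProduct.mapL (shear K E) (shear L F) *
      TensorProduct.mapL (shear K (-E)) (shear L (-F)) = 1 := by
    rw [← TensorProduct.mapL_mul, shear_mul_shear_neg, shear_mul_shear_neg]
    exact TensorProduct.mapL_id_id
  exact DFunLike.congr_fun hinv (y k)

theorem contDiff_rectangleChart {ν : Type*} [Fintype ν] (K : Submodule ℝ V) (L : Submodule ℝ U) :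
    ContDiff ℝ 1 (rectangleChart (ν := ν) K L) := by
  have hK : ContDiff ℝ 1 (shear K) := by unfold shear; fun_prop
  have hL : ContDiff ℝ 1 (shear L) := by unfold shear; fun_prop
  refine contDiff_pi.2 fun k => ContDiff.clm_apply
    (contDiff_mapL (hK.comp contDiff_fst) (hL.comp (contDiff_fst.comp contDiff_snd))) ?_
  exact (tensorSubmodule Kᗮ Lᗮ)ᗮ.subtypeL.contDiff.comp
    ((contDiff_apply ℝ _ k).comp (contDiff_snd.comp contDiff_snd))

-- Cross-multiplying `1 ≤ t / p + r / q` bounds both `t' / p` and `r' / q` in terms of `r` and `t`.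
theorem mul_add_mul_add_mul_lt {p q m t t' r r' s : ℕ} (hp : t' + t = p) (hq : r' + r = q)
    (hs : t * r + s = p * q) (ht : 0 < t) (hr : 0 < r) (h : p * q ≤ t * q + r * p)
    (hm : p ^ 2 + q ^ 2 < m * (p * q)) : t' * t + r' * r + m * s < m * (p * q) := by
  have ht' : q * t' ≤ r * p := by subst hp; nlinarith
  have hr' : p * r' ≤ t * q := by subst hq; nlinarith
  have hshear : p * q * (t' * t + r' * r) < p * q * (m * (t * r)) := by
    calc p * q * (t' * t + r' * r) = p * t * (q * t') + q * r * (p * r') := by ring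
      _ ≤ p * t * (r * p) + q * r * (t * q) := by gcongr
      _ = (p ^ 2 + q ^ 2) * (t * r) := by ring
      _ < m * (p * q) * (t * r) := by gcongr
      _ = p * q * (m * (t * r)) := by ring
  rw [← hs, mul_add]
  exact Nat.add_lt_add_right (Nat.lt_of_mul_lt_mul_left hshear) _

theorem finrank_rectangleChart_lt {ν : Type*} [Fintype ν] {K W : Submodule ℝ V}
    {L Z : Submodule ℝ U} (hK : IsCompl K W) (hL : IsCompl L Z) (hW : W ≠ ⊥) (hZ : Z ≠ ⊥)
    (h : Module.finrank ℝ V * Module.finrank ℝ U ≤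
      Module.finrank ℝ W * Module.finrank ℝ U + Module.finrank ℝ Z * Module.finrank ℝ V)
    (hm : Module.finrank ℝ V ^ 2 + Module.finrank ℝ U ^ 2 <
      Fintype.card ν * (Module.finrank ℝ V * Module.finrank ℝ U)) :
    Module.finrank ℝ ((K →L[ℝ] Kᗮ) × (L →L[ℝ] Lᗮ) × (ν → (tensorSubmodule Kᗮ Lᗮ)ᗮ)) <
      Module.finrank ℝ (ν → V ⊗[ℝ] U) := by
  have hp := K.finrank_add_finrank_orthogonal
  have hq := L.finrank_add_finrank_orthogonal
  have hs := (tensorSubmodule Kᗮ Lᗮ).finrank_add_finrank_orthogonal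
  have hKW : Module.finrank ℝ Kᗮ = Module.finrank ℝ W := by
    linarith [Submodule.finrank_add_eq_of_isCompl hK]
  have hLZ : Module.finrank ℝ Lᗮ = Module.finrank ℝ Z := by
    linarith [Submodule.finrank_add_eq_of_isCompl hL]
  rw [finrank_tensorSubmodule, Module.finrank_tensorProduct] at hs
  rw [← Submodule.one_le_finrank_iff, ← hKW] at hW
  rw [← Submodule.one_le_finrank_iff, ← hLZ] at hZ
  rw [← hKW, ← hLZ] at h
  have := mul_add_mul_add_mul_lt hp hq hs hW hZ h hm
  simpa [Module.finrank_pi_fintype, Module.finrank_tensorProduct, add_assoc,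
    ← LinearMap.toContinuousLinearMap.finrank_eq, Module.finrank_linearMap] using this

variable [MeasurableSpace (V ⊗[ℝ] U)] [BorelSpace (V ⊗[ℝ] U)]

theorem ae_isStableTuple {ν : Type*} [Fintype ν] (μ : Measure (ν → V ⊗[ℝ] U))
    [μ.IsAddHaarMeasure] (hν : Module.finrank ℝ V ^ 2 + Module.finrank ℝ U ^ 2 <
      Fintype.card ν * (Module.finrank ℝ V * Module.finrank ℝ U)) :
    ∀ᵐ y ∂μ, IsStableTuple y := by
  let v := stdOrthonormalBasis ℝ V
  let u := stdOrthonormalBasis ℝ U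
  let K (s : Set (Fin (Module.finrank ℝ V))) : Submodule ℝ V := Submodule.span ℝ (v '' s)
  let L (t : Set (Fin (Module.finrank ℝ U))) : Submodule ℝ U := Submodule.span ℝ (u '' t)
  let chartTooSmall (s : Set (Fin (Module.finrank ℝ V))) (t : Set (Fin (Module.finrank ℝ U))) :=
    Module.finrank ℝ ((K s →L[ℝ] (K s)ᗮ) × (L t →L[ℝ] (L t)ᗮ) ×
      (ν → (tensorSubmodule (K s)ᗮ (L t)ᗮ)ᗮ)) < Module.finrank ℝ (ν → V ⊗[ℝ] U)
  have hnull : μ (⋃ (s) (t) (_ : chartTooSmall s t),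
      Set.range (rectangleChart (ν := ν) (K s) (L t))) = 0 :=
    measure_iUnion_null fun s => measure_iUnion_null fun t => measure_iUnion_null fun hst =>
      addHaar_range_eq_zero_of_contDiff μ (contDiff_rectangleChart (K s) (L t)) hst
  refine measure_mono_null (fun y hy => ?_) hnull
  simp only [IsStableTuple, Set.mem_compl_iff, Set.mem_ofPred_eq] at hy
  push Not at hy
  obtain ⟨W, Z, hW, hZ, hy, hdim⟩ := hy
  obtain ⟨s, hs⟩ := exists_isCompl_span_image v.toBasis.span_eq W
  obtain ⟨t, ht⟩ := exists_isCompl_span_image u.toBasis.span_eq Z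
  rw [OrthonormalBasis.coe_toBasis] at hs ht
  exact Set.mem_iUnion₂.2 ⟨s, t, Set.mem_iUnion.2
    ⟨finrank_rectangleChart_lt hs ht hW hZ hdim hν, mem_range_rectangleChart hs ht hy⟩⟩

end Stable

theorem JointlyContinuous.succ_sub_zero {Ω E : Type*} [MeasurableSpace Ω] [NormedAddCommGroup E]
    [InnerProductSpace ℝ E] [FiniteDimensional ℝ E] [MeasurableSpace E] [BorelSpace E]
    {μ : Measure Ω} {m : ℕ} {X : Fin (m + 1) → Ω → E} (hX : JointlyContinuous X μ) :
    JointlyContinuous (fun (i : Fin m) ω => X i.succ ω - X 0 ω) μ := by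
  let D : (Fin (m + 1) → E) →ₗ[ℝ] (Fin m → E) :=
    LinearMap.pi fun i => LinearMap.proj (R := ℝ) (φ := fun _ => E) i.succ -
      LinearMap.proj (R := ℝ) (φ := fun _ => E) 0
  have hD : Measurable D := D.continuous_of_finiteDimensional.measurable
  have hsurj : Function.Surjective D := fun y =>
    ⟨Fin.cons 0 y, funext fun i => by simp [D]⟩
  obtain ⟨c, -, hc⟩ := D.exists_map_addHaar_eq_smul_addHaar volume volume hsurj
  refine ⟨hD.comp_aemeasurable hX.1, ?_⟩
  change μ.map (D ∘ fun ω i => X i ω) ≪ volume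
  rw [← AEMeasurable.map_map_of_aemeasurable hD.aemeasurable hX.1]
  exact (hX.2.map hD).trans (hc ▸ Measure.smul_absolutelyContinuous)

section DiagOp

variable {E ι : Type*} [NormedAddCommGroup E] [InnerProductSpace ℝ E] [Fintype ι]

/-- The self-adjoint operator `∑ aᵢ eᵢ eᵢᵀ` attached to a frame `e` and weights `a`; for an
orthonormal basis `e` it is the operator with eigenvectors `eᵢ` and eigenvalues `aᵢ`. -/
noncomputable def diagOp (e : ι → E) (a : ι → ℝ) : E →L[ℝ] E :=
  ∑ i, a i • InnerProductSpace.rankOne ℝ (e i) (e i)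

theorem diagOp_apply (e : ι → E) (a : ι → ℝ) (x : E) :
    diagOp e a x = ∑ i, (a i * inner ℝ (e i) x) • e i := by
  simp [diagOp, smul_smul]

theorem diagOp_one (v : OrthonormalBasis ι ℝ E) : diagOp v 1 = 1 := by
  simp only [diagOp, Pi.one_apply, one_smul]
  exact v.sum_rankOne_eq_id

theorem diagOp_mul_diagOp (v : OrthonormalBasis ι ℝ E) (a b : ι → ℝ) :
    diagOp v a * diagOp v b = diagOp v (a * b) := by
  ext x
  rw [mul_apply_eq_comp, diagOp_apply v b, map_sum, diagOp_apply]
  refine Finset.sum_congr rfl fun i _ => ?_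
  have hv : diagOp v a (v i) = a i • v i := by
    classical
    simp [diagOp_apply, v.inner_eq_ite]
  rw [map_smul, hv, smul_smul, Pi.mul_apply, mul_right_comm, mul_comm (a i)]

theorem isSymmetric_diagOp (e : ι → E) (a : ι → ℝ) : (diagOp e a : E →ₗ[ℝ] E).IsSymmetric := by
  intro x y
  simp only [ContinuousLinearMap.coe_coe, diagOp_apply, sum_inner, inner_sum,
    real_inner_smul_left, real_inner_smul_right]
  refine Finset.sum_congr rfl fun i _ => ?_
  rw [real_inner_comm x (e i)]
  ring

theorem inner_diagOp_self (e : ι → E) (a : ι → ℝ) (x : E) :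
    inner ℝ (diagOp e a x) x = ∑ i, a i * inner ℝ x (e i) ^ 2 := by
  rw [diagOp_apply, sum_inner]
  refine Finset.sum_congr rfl fun i _ => ?_
  rw [real_inner_smul_left, real_inner_comm x (e i)]
  ring

theorem mul_sq_norm_le_inner_diagOp (v : OrthonormalBasis ι ℝ E) {a : ι → ℝ} {r : ℝ}
    (ha : ∀ i, r ≤ a i) (x : E) : r * ‖x‖ ^ 2 ≤ inner ℝ (diagOp v a x) x := by
  rw [inner_diagOp_self, ← v.sum_sq_inner_left, Finset.mul_sum]
  exact Finset.sum_le_sum fun i _ => mul_le_mul_of_nonneg_right (ha i) (sq_nonneg _)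

theorem diagOp_mem_posDefOperators (e : Module.Basis ι ℝ E) {a : ι → ℝ} (ha : ∀ i, 0 < a i) :
    diagOp e a ∈ posDefOperators E := by
  refine ⟨isSymmetric_diagOp e a, fun x hx => ?_⟩
  obtain ⟨i, hi⟩ : ∃ i, inner ℝ x (e i) ≠ 0 := by
    by_contra! h
    exact hx (InnerProductSpace.ext_inner_right_basis e fun i => by rw [h, inner_zero_left])
  rw [inner_diagOp_self]
  exact Finset.sum_pos' (fun j _ => mul_nonneg (ha j).le (sq_nonneg _))
    ⟨i, Finset.mem_univ i, mul_pos (ha i) (sq_pos_of_ne_zero hi)⟩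

theorem det_diagOp [DecidableEq ι] (e : Module.Basis ι ℝ E) (a : ι → ℝ) :
    (diagOp e a).det = (∏ i, a i) * (Matrix.gram ℝ e).det := by
  have h : LinearMap.toMatrix e e (diagOp e a) = Matrix.diagonal a * Matrix.gram ℝ e := by
    ext i j
    rw [LinearMap.toMatrix_apply, ContinuousLinearMap.coe_coe, diagOp_apply,
      Module.Basis.repr_sum_self, Matrix.diagonal_mul, Matrix.gram_apply]
  rw [ContinuousLinearMap.det, ← LinearMap.det_toMatrix e, h, Matrix.det_mul, Matrix.det_diagonal]

theorem log_det_diagOp_exp [DecidableEq ι] (e : Module.Basis ι ℝ E) (a : ι → ℝ) :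
    Real.log (diagOp e fun i => Real.exp (a i)).det =
      ∑ i, a i + Real.log (Matrix.gram ℝ e).det := by
  have hgram := (Matrix.posDef_gram_of_linearIndependent e.linearIndependent).det_pos
  rw [det_diagOp, Real.log_mul (Finset.prod_ne_zero_iff.2 fun i _ => Real.exp_ne_zero _) hgram.ne',
    ← Real.exp_sum, Real.log_exp]

theorem continuous_diagOp : Continuous fun z : (ι → E) × (ι → ℝ) => diagOp z.1 z.2 := by
  have hrank (i : ι) : Continuous fun z : (ι → E) × (ι → ℝ) =>
      InnerProductSpace.rankOne ℝ (z.1 i) (z.1 i) := by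
    have h : Continuous fun z : (ι → E) × (ι → ℝ) => z.1 i := by fun_prop
    exact ((InnerProductSpace.rankOne ℝ).continuous.comp h).clm_apply h
  exact continuous_finsetSum _ fun i _ =>
    ((continuous_apply i).comp continuous_snd).smul (hrank i)

theorem isCompact_setOf_orthonormal {ι : Type*} [Finite ι] [FiniteDimensional ℝ E] :
    IsCompact {e : ι → E | Orthonormal ℝ e} := by
  classical
  have := Fintype.ofFinite ι
  refine Metric.isCompact_of_isClosed_isBounded ?closed ?bounded
  case closed =>
    simp only [orthonormal_iff_ite, Set.ofPred_forall]
    refine isClosed_iInter fun i => isClosed_iInter fun j => isClosed_eq ?_ continuous_const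
    fun_prop
  case bounded =>
    refine (Metric.isBounded_closedBall (x := (0 : ι → E)) (r := 1)).subset fun e he => ?_
    rw [mem_closedBall_zero_iff, pi_norm_le_iff_of_nonneg zero_le_one]
    exact fun i => (he.norm_eq_one i).le

end DiagOp

section PositiveDefinite

variable {E : Type*} [NormedAddCommGroup E] [InnerProductSpace ℝ E]

theorem inner_nonneg_of_mem_posDefOperators {T : E →L[ℝ] E} (hT : T ∈ posDefOperators E) (x : E) :
    0 ≤ inner ℝ (T x) x := by
  rcases eq_or_ne x 0 with rfl | hx
  · rw [inner_zero_right]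
  · exact (hT.2 x hx).le

variable [FiniteDimensional ℝ E]

theorem det_ne_zero_of_mem_posDefOperators {T : E →L[ℝ] E} (hT : T ∈ posDefOperators E) :
    T.det ≠ 0 := by
  intro hdet
  obtain ⟨x, hx, hx0⟩ := SetLike.exists_of_lt (LinearMap.bot_lt_ker_of_det_eq_zero hdet)
  have hpos := hT.2 x (by simpa using hx0)
  rw [show T x = 0 from hx, inner_zero_left] at hpos
  exact hpos.false

theorem exists_eq_diagOp_exp {T : E →L[ℝ] E} (hT : T ∈ posDefOperators E) :
    ∃ (v : OrthonormalBasis (Fin (Module.finrank ℝ E)) ℝ E) (a : Fin (Module.finrank ℝ E) → ℝ),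
      T = diagOp v fun i => Real.exp (a i) := by
  set v := hT.1.eigenvectorBasis rfl
  set l := hT.1.eigenvalues rfl
  have hv (i) : T (v i) = l i • v i := hT.1.apply_eigenvectorBasis rfl i
  have hl (i) : 0 < l i := by
    have := hT.2 (v i) (v.orthonormal.ne_zero i)
    rwa [hv, real_inner_smul_left, real_inner_self_eq_norm_sq, v.norm_eq_one, one_pow,
      mul_one] at this
  refine ⟨v, fun i => Real.log (l i), ContinuousLinearMap.ext fun x => ?_⟩
  rw [diagOp_apply]
  conv_lhs => rw [← v.sum_repr' x, map_sum]
  refine Finset.sum_congr rfl fun i _ => ?_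
  rw [map_smul, hv, smul_smul, Real.exp_log (hl i), mul_comm]

theorem star_diagOp {ι : Type*} [Fintype ι] (e : ι → E) (a : ι → ℝ) :
    star (diagOp e a) = diagOp e a :=
  ContinuousLinearMap.isSelfAdjoint_iff_isSymmetric.2 (isSymmetric_diagOp e a)

theorem mul_diagOp_mul_star {ι : Type*} [Fintype ι] (R : E →L[ℝ] E) (e : ι → E) (a : ι → ℝ) :
    R * diagOp e a * star R = diagOp (fun i => R (e i)) a := by
  ext x
  simp only [mul_apply_eq_comp, diagOp_apply, map_sum, map_smul,
    ContinuousLinearMap.star_eq_adjoint, ContinuousLinearMap.adjoint_inner_right]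

theorem mul_mul_star_mem_posDefOperators {T : E →L[ℝ] E} (hT : T ∈ posDefOperators E)
    (R : (E →L[ℝ] E)ˣ) : (R : E →L[ℝ] E) * T * star (R : E →L[ℝ] E) ∈ posDefOperators E := by
  have hsymm : IsSelfAdjoint T := ContinuousLinearMap.isSelfAdjoint_iff_isSymmetric.2 hT.1
  refine ⟨ContinuousLinearMap.isSelfAdjoint_iff_isSymmetric.1 (hsymm.conjugate _), fun x hx => ?_⟩
  have hRx : star (R : E →L[ℝ] E) x ≠ 0 := fun h0 => hx <| by
    have hinv : star (↑R⁻¹ : E →L[ℝ] E) * star (R : E →L[ℝ] E) = 1 :=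
      (star R).inv_mul
    simpa [h0] using (congrArg (fun S : E →L[ℝ] E => S x) hinv).symm
  have := hT.2 _ hRx
  rwa [ContinuousLinearMap.star_eq_adjoint, ContinuousLinearMap.adjoint_inner_right] at this

theorem exists_eq_units_mul_star {T : E →L[ℝ] E} (hT : T ∈ posDefOperators E) :
    ∃ R : (E →L[ℝ] E)ˣ, T = (R : E →L[ℝ] E) * star (R : E →L[ℝ] E) := by
  obtain ⟨v, a, rfl⟩ := exists_eq_diagOp_exp hT
  have hmul (b c : Fin (Module.finrank ℝ E) → ℝ) :
      diagOp v (fun i => Real.exp (b i)) * diagOp v (fun i => Real.exp (c i)) =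
        diagOp v fun i => Real.exp (b i + c i) := by
    simp only [diagOp_mul_diagOp, Real.exp_add]
    rfl
  have hone : diagOp v (fun _ => Real.exp 0) = 1 := by
    rw [Real.exp_zero]
    exact diagOp_one v
  refine ⟨⟨diagOp v fun i => Real.exp (a i / 2), diagOp v fun i => Real.exp (-(a i / 2)), ?_, ?_⟩,
    ?_⟩
  · simpa only [hmul, add_neg_cancel] using hone
  · simpa only [hmul, neg_add_cancel] using hone
  · simp only [star_diagOp, hmul, add_halves]

theorem exists_basis_eq_diagOp_one_and_eq_diagOp_exp {S T : E →L[ℝ] E}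
    (hS : S ∈ posDefOperators E) (hT : T ∈ posDefOperators E) :
    ∃ (e : Module.Basis (Fin (Module.finrank ℝ E)) ℝ E) (a : Fin (Module.finrank ℝ E) → ℝ),
      S = diagOp e 1 ∧ T = diagOp e fun i => Real.exp (a i) := by
  obtain ⟨R, rfl⟩ := exists_eq_units_mul_star hS
  obtain ⟨w, a, hw⟩ := exists_eq_diagOp_exp (mul_mul_star_mem_posDefOperators hT R⁻¹)
  let e := w.toBasis.map (ContinuousLinearEquiv.ofUnit R).toLinearEquiv
  have he : ⇑e = fun i => (R : E →L[ℝ] E) (w i) := by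
    ext i
    simp [e, ContinuousLinearEquiv.ofUnit]
  refine ⟨e, a, ?_, ?_⟩
  · rw [he, ← mul_diagOp_mul_star, diagOp_one, mul_one]
  · have hinv : star (↑R⁻¹ : E →L[ℝ] E) * star (R : E →L[ℝ] E) = 1 :=
      (star R).inv_mul
    rw [he, ← mul_diagOp_mul_star, ← hw]
    calc T = (R * ↑R⁻¹) * T * (star (↑R⁻¹ : E →L[ℝ] E) * star (R : E →L[ℝ] E)) := by
          rw [hinv, R.mul_inv, one_mul, mul_one]
      _ = R * (↑R⁻¹ * T * star (↑R⁻¹ : E →L[ℝ] E)) * star (R : E →L[ℝ] E) := by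
          simp only [mul_assoc]

end PositiveDefinite

section KroneckerDiag

variable {V U ι κ : Type*} [NormedAddCommGroup V] [InnerProductSpace ℝ V]
  [NormedAddCommGroup U] [InnerProductSpace ℝ U]

theorem continuous_tmul_apply (i : ι) (j : κ) :
    Continuous fun z : (ι → V) × (κ → U) => z.1 i ⊗ₜ[ℝ] z.2 j := by
  have htmul : Continuous fun x : V × U => x.1 ⊗ₜ[ℝ] x.2 := TensorProduct.continuous_tmul
  have hpair : Continuous fun z : (ι → V) × (κ → U) => (z.1 i, z.2 j) := by fun_prop
  exact htmul.comp hpair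

variable [Fintype ι] [Fintype κ]

/-- The Kronecker product of the self-adjoint operators with frames `e`, `f` and weights `exp aᵢ`,
`exp bⱼ`; the weights are parametrized by their logarithms because the operator then depends on
`a` and `b` only through the sums `aᵢ + bⱼ`. -/
noncomputable def kroneckerDiag (e : ι → V) (f : κ → U) (a : ι → ℝ) (b : κ → ℝ) :
    V ⊗[ℝ] U →L[ℝ] V ⊗[ℝ] U :=
  diagOp (fun x : ι × κ => e x.1 ⊗ₜ[ℝ] f x.2) fun x => Real.exp (a x.1 + b x.2)

theorem kroneckerDiag_congr (e : ι → V) (f : κ → U) {a a' : ι → ℝ} {b b' : κ → ℝ}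
    (h : ∀ i j, a' i + b' j = a i + b j) : kroneckerDiag e f a' b' = kroneckerDiag e f a b := by
  simp only [kroneckerDiag, h]

theorem mapL_diagOp_exp (e : ι → V) (f : κ → U) (a : ι → ℝ) (b : κ → ℝ) :
    TensorProduct.mapL (diagOp e fun i => Real.exp (a i)) (diagOp f fun j => Real.exp (b j)) =
      kroneckerDiag e f a b := by
  refine ContinuousLinearMap.coe_injective (TensorProduct.ext' fun x y => ?_)
  change diagOp e _ x ⊗ₜ[ℝ] diagOp f _ y = diagOp _ _ (x ⊗ₜ[ℝ] y)
  simp only [diagOp_apply, Fintype.sum_prod_type, TensorProduct.sum_tmul, TensorProduct.tmul_sum,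
    TensorProduct.inner_tmul, TensorProduct.smul_tmul_smul, Real.exp_add]
  rw [Finset.sum_comm]
  simp only [mul_mul_mul_comm]

theorem kroneckerDiag_basis (e : Module.Basis ι ℝ V) (f : Module.Basis κ ℝ U) (a : ι → ℝ)
    (b : κ → ℝ) :
    kroneckerDiag e f a b = diagOp (e.tensorProduct f) fun x => Real.exp (a x.1 + b x.2) := by
  simp only [kroneckerDiag, ← Module.Basis.tensorProduct_apply']

theorem kroneckerDiag_orthonormalBasis (v : OrthonormalBasis ι ℝ V) (u : OrthonormalBasis κ ℝ U)
    (a : ι → ℝ) (b : κ → ℝ) :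
    kroneckerDiag v u a b = diagOp (v.tensorProduct u) fun x => Real.exp (a x.1 + b x.2) := by
  simp only [kroneckerDiag, ← OrthonormalBasis.tensorProduct_apply']

theorem kroneckerDiag_mem_kroneckerCone (e : Module.Basis ι ℝ V) (f : Module.Basis κ ℝ U)
    (a : ι → ℝ) (b : κ → ℝ) : kroneckerDiag e f a b ∈ kroneckerCone V U :=
  ⟨_, diagOp_mem_posDefOperators e fun _ => Real.exp_pos _,
    _, diagOp_mem_posDefOperators f fun _ => Real.exp_pos _, (mapL_diagOp_exp e f a b).symm⟩

theorem continuous_kroneckerDiag :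
    Continuous fun z : ((ι → V) × (κ → U)) × ((ι → ℝ) × (κ → ℝ)) =>
      kroneckerDiag z.1.1 z.1.2 z.2.1 z.2.2 := by
  have hframe : Continuous fun z : ((ι → V) × (κ → U)) × ((ι → ℝ) × (κ → ℝ)) =>
      fun x : ι × κ => z.1.1 x.1 ⊗ₜ[ℝ] z.1.2 x.2 :=
    continuous_pi fun x => (continuous_tmul_apply x.1 x.2).comp continuous_fst
  have hweight : Continuous fun z : ((ι → V) × (κ → U)) × ((ι → ℝ) × (κ → ℝ)) =>
      fun x : ι × κ => Real.exp (z.2.1 x.1 + z.2.2 x.2) := by fun_prop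
  have hdiag := (continuous_diagOp (E := V ⊗[ℝ] U)).comp (hframe.prodMk hweight)
  exact hdiag

variable [FiniteDimensional ℝ V] [FiniteDimensional ℝ U]

theorem exists_eq_kroneckerDiag {Θ : V ⊗[ℝ] U →L[ℝ] V ⊗[ℝ] U} (hΘ : Θ ∈ kroneckerCone V U) :
    ∃ (v : OrthonormalBasis (Fin (Module.finrank ℝ V)) ℝ V)
      (u : OrthonormalBasis (Fin (Module.finrank ℝ U)) ℝ U) (a : Fin (Module.finrank ℝ V) → ℝ)
      (b : Fin (Module.finrank ℝ U) → ℝ), Θ = kroneckerDiag v u a b := by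
  obtain ⟨P, hP, Q, hQ, rfl⟩ := hΘ
  obtain ⟨v, a, rfl⟩ := exists_eq_diagOp_exp hP
  obtain ⟨u, b, rfl⟩ := exists_eq_diagOp_exp hQ
  exact ⟨v, u, a, b, mapL_diagOp_exp v u a b⟩

theorem exists_basis_eq_kroneckerDiag_zero_and_eq_kroneckerDiag
    {Θ₁ Θ₂ : V ⊗[ℝ] U →L[ℝ] V ⊗[ℝ] U} (h₁ : Θ₁ ∈ kroneckerCone V U) (h₂ : Θ₂ ∈ kroneckerCone V U) :
    ∃ (e : Module.Basis (Fin (Module.finrank ℝ V)) ℝ V)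
      (f : Module.Basis (Fin (Module.finrank ℝ U)) ℝ U) (a : Fin (Module.finrank ℝ V) → ℝ)
      (b : Fin (Module.finrank ℝ U) → ℝ),
      Θ₁ = kroneckerDiag e f 0 0 ∧ Θ₂ = kroneckerDiag e f a b := by
  obtain ⟨P₁, hP₁, Q₁, hQ₁, rfl⟩ := h₁
  obtain ⟨P₂, hP₂, Q₂, hQ₂, rfl⟩ := h₂
  obtain ⟨e, a, rfl, rfl⟩ := exists_basis_eq_diagOp_one_and_eq_diagOp_exp hP₁ hP₂
  obtain ⟨f, b, rfl, rfl⟩ := exists_basis_eq_diagOp_one_and_eq_diagOp_exp hQ₁ hQ₂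
  refine ⟨e, f, a, b, ?_, mapL_diagOp_exp e f a b⟩
  rw [← mapL_diagOp_exp]
  simp only [Pi.zero_apply, Real.exp_zero]
  rfl

theorem kroneckerCone_subset_posDefOperators :
    kroneckerCone V U ⊆ posDefOperators (V ⊗[ℝ] U) := by
  intro Θ hΘ
  obtain ⟨e, f, a, b, -, rfl⟩ := exists_basis_eq_kroneckerDiag_zero_and_eq_kroneckerDiag hΘ hΘ
  rw [kroneckerDiag_basis]
  exact diagOp_mem_posDefOperators _ fun _ => Real.exp_pos _

theorem isCompact_setOf_kroneckerDiag (hι : Fintype.card ι = Module.finrank ℝ V)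
    (hκ : Fintype.card κ = Module.finrank ℝ U) (C : ℝ) :
    IsCompact {Θ : kroneckerCone V U | ∃ (e : ι → V) (f : κ → U) (a : ι → ℝ) (b : κ → ℝ),
      Orthonormal ℝ e ∧ Orthonormal ℝ f ∧ ‖(a, b)‖ ≤ C ∧
        (Θ : V ⊗[ℝ] U →L[ℝ] V ⊗[ℝ] U) = kroneckerDiag e f a b} := by
  set D : Set (((ι → V) × (κ → U)) × ((ι → ℝ) × (κ → ℝ))) :=
    ({e | Orthonormal ℝ e} ×ˢ {f | Orthonormal ℝ f}) ×ˢ Metric.closedBall 0 C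
  have hD : IsCompact D := (isCompact_setOf_orthonormal.prod isCompact_setOf_orthonormal).prod
    (isCompact_closedBall 0 C)
  have hrange : (fun z => kroneckerDiag z.1.1 z.1.2 z.2.1 z.2.2) '' D ⊆
      Set.range ((↑) : kroneckerCone V U → V ⊗[ℝ] U →L[ℝ] V ⊗[ℝ] U) := by
    rintro _ ⟨⟨⟨e, f⟩, a, b⟩, ⟨⟨he, hf⟩, -⟩, rfl⟩
    have hmem := kroneckerDiag_mem_kroneckerCone
      (Module.Basis.mk he.linearIndependent
        (he.linearIndependent.span_eq_top_of_card_eq_finrank' hι).ge)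
      (Module.Basis.mk hf.linearIndependent
        (hf.linearIndependent.span_eq_top_of_card_eq_finrank' hκ).ge) a b
    rw [Module.Basis.coe_mk, Module.Basis.coe_mk] at hmem
    exact ⟨⟨_, hmem⟩, rfl⟩
  convert (Topology.IsInducing.subtypeVal.isCompact_preimage_iff hrange).2
    (hD.image continuous_kroneckerDiag) using 1
  ext Θ
  constructor
  · rintro ⟨e, f, a, b, he, hf, hab, hΘ⟩
    exact ⟨((e, f), (a, b)), ⟨⟨he, hf⟩, mem_closedBall_zero_iff.2 hab⟩, hΘ.symm⟩
  · rintro ⟨⟨⟨e, f⟩, a, b⟩, ⟨⟨he, hf⟩, hab⟩, hΘ⟩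
    exact ⟨e, f, a, b, he, hf, mem_closedBall_zero_iff.1 hab, hΘ.symm⟩

end KroneckerDiag

section Moments

variable {E : Type*} [NormedAddCommGroup E] [InnerProductSpace ℝ E] {n : ℕ}

/-- The sample mean `x̄ = (1/n) ∑ xᵢ`. -/
noncomputable def sampleMean (x : Fin n → E) : E := (1 / (n : ℝ)) • ∑ i, x i

/-- The second moment `(1/n) ∑ ⟪yᵢ, v⟫²` of a sample `y` in the direction `v`. -/
noncomputable def secondMoment (y : Fin n → E) (v : E) : ℝ :=
  (1 / (n : ℝ)) * ∑ i, inner ℝ (y i) v ^ 2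

theorem secondMoment_nonneg (y : Fin n → E) (v : E) : 0 ≤ secondMoment y v :=
  mul_nonneg (by positivity) (Finset.sum_nonneg fun _ _ => sq_nonneg _)

theorem secondMoment_pos {y : Fin n → E} {v : E} (h : ∃ i, inner ℝ (y i) v ≠ 0) :
    0 < secondMoment y v := by
  obtain ⟨i, hi⟩ := h
  have hn : 0 < n := i.pos
  exact mul_pos (by positivity) (Finset.sum_pos' (fun _ _ => sq_nonneg _)
    ⟨i, Finset.mem_univ i, sq_pos_of_ne_zero hi⟩)

theorem continuous_secondMoment (y : Fin n → E) : Continuous (secondMoment y) := by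
  unfold secondMoment
  fun_prop

theorem mean_inner_diagOp_self {ι : Type*} [Fintype ι] (y : Fin n → E) (e : ι → E) (a : ι → ℝ) :
    (1 / (n : ℝ)) * ∑ i, inner ℝ (diagOp e a (y i)) (y i) = ∑ j, secondMoment y (e j) * a j := by
  simp only [inner_diagOp_self, secondMoment]
  rw [Finset.sum_comm, Finset.mul_sum]
  refine Finset.sum_congr rfl fun j _ => ?_
  rw [← Finset.mul_sum]
  ring

theorem sum_sub_sampleMean (hn : n ≠ 0) (x : Fin n → E) : ∑ i, (x i - sampleMean x) = 0 := by
  rw [Finset.sum_sub_distrib, Finset.sum_const, Finset.card_univ, Fintype.card_fin, sampleMean,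
    ← Nat.cast_smul_eq_nsmul ℝ, smul_smul, mul_one_div_cancel (Nat.cast_ne_zero.2 hn), one_smul,
    sub_self]

theorem mean_inner_sub_eq_add (hn : n ≠ 0) {T : E →L[ℝ] E} (hT : (T : E →ₗ[ℝ] E).IsSymmetric)
    (x : Fin n → E) (M : E) :
    (1 / (n : ℝ)) * ∑ i, inner ℝ (T (x i - M)) (x i - M) =
      (1 / (n : ℝ)) * ∑ i, inner ℝ (T (x i - sampleMean x)) (x i - sampleMean x) +
        inner ℝ (T (sampleMean x - M)) (sampleMean x - M) := by
  set w := sampleMean x - M with hw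
  have hterm (i : Fin n) : inner ℝ (T (x i - M)) (x i - M) =
      inner ℝ (T (x i - sampleMean x)) (x i - sampleMean x) +
        2 * inner ℝ (T w) (x i - sampleMean x) + inner ℝ (T w) w := by
    rw [← sub_add_sub_cancel (x i) (sampleMean x) M, ← hw, map_add, inner_add_left,
      inner_add_right, inner_add_right, hT.apply_clm (x i - sampleMean x) w,
      real_inner_comm (T w) (x i - sampleMean x)]
    ring
  have hcross : ∑ i, inner ℝ (T w) (x i - sampleMean x) = 0 := by
    rw [← inner_sum, sum_sub_sampleMean hn, inner_zero_right]
  simp only [hterm, Finset.sum_add_distrib, ← Finset.mul_sum, hcross, Finset.sum_const,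
    Finset.card_univ, Fintype.card_fin, nsmul_eq_mul]
  field_simp
  ring

theorem continuous_mean_inner_sub_log_det [FiniteDimensional ℝ E] {S : Set (E →L[ℝ] E)}
    (hS : S ⊆ posDefOperators E) (x : Fin n → E) : Continuous fun s : E × S =>
      (1 / (n : ℝ)) * ∑ i, inner ℝ ((s.2 : E →L[ℝ] E) (x i - s.1)) (x i - s.1) -
        Real.log (s.2 : E →L[ℝ] E).det := by
  refine Continuous.sub (by fun_prop) (Continuous.log ?_ fun s =>
    det_ne_zero_of_mem_posDefOperators (hS s.2.2))
  exact ContinuousLinearMap.continuous_det.comp (continuous_subtype_val.comp continuous_snd)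

end Moments

section Likelihood

variable {V U ι κ : Type*} [NormedAddCommGroup V] [InnerProductSpace ℝ V]
  [NormedAddCommGroup U] [InnerProductSpace ℝ U] [Fintype ι] [Fintype κ] {n : ℕ}

theorem gaussianNLL_eq_of_basis [DecidableEq ι] [DecidableEq κ] (x : Fin n → V ⊗[ℝ] U)
    (M : V ⊗[ℝ] U) (e : Module.Basis ι ℝ V) (f : Module.Basis κ ℝ U) (a : ι → ℝ) (b : κ → ℝ)
    {Θ : kroneckerCone V U} (hΘ : (Θ : V ⊗[ℝ] U →L[ℝ] V ⊗[ℝ] U) = kroneckerDiag e f a b) :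
    gaussianNLL x (M, Θ) =
      separableEnergy (fun i j => secondMoment (fun k => x k - M) (e i ⊗ₜ[ℝ] f j)) a b -
        Real.log (Matrix.gram ℝ (e.tensorProduct f)).det := by
  have hdet := log_det_diagOp_exp (e.tensorProduct f) fun x => a x.1 + b x.2
  simp only [gaussianNLL, hΘ, kroneckerDiag_basis, hdet, mean_inner_diagOp_self, separableEnergy,
    Finset.sum_sub_distrib, Module.Basis.tensorProduct_apply', sub_sub]

theorem gaussianNLL_eq_of_orthonormalBasis (x : Fin n → V ⊗[ℝ] U) (M : V ⊗[ℝ] U)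
    (v : OrthonormalBasis ι ℝ V) (u : OrthonormalBasis κ ℝ U) (a : ι → ℝ) (b : κ → ℝ)
    {Θ : kroneckerCone V U} (hΘ : (Θ : V ⊗[ℝ] U →L[ℝ] V ⊗[ℝ] U) = kroneckerDiag v u a b) :
    gaussianNLL x (M, Θ) =
      separableEnergy (fun i j => secondMoment (fun k => x k - M) (v i ⊗ₜ[ℝ] u j)) a b := by
  classical
  have hgram : Matrix.gram ℝ (v.toBasis.tensorProduct u.toBasis) = 1 := by
    refine (Matrix.gram_eq_one_iff_orthonormal (E := V ⊗[ℝ] U)).2 ?_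
    rw [← OrthonormalBasis.toBasis_tensorProduct, OrthonormalBasis.coe_toBasis]
    exact (v.tensorProduct u).orthonormal
  rw [← v.coe_toBasis, ← u.coe_toBasis] at hΘ ⊢
  rw [gaussianNLL_eq_of_basis x M v.toBasis u.toBasis a b hΘ, hgram, Matrix.det_one, Real.log_one,
    sub_zero]

theorem IsStableTuple.strictHall_secondMoment_pos {y : Fin n → V ⊗[ℝ] U} (hy : IsStableTuple y)
    {e : ι → V} {f : κ → U} (he : LinearIndependent ℝ e) (hf : LinearIndependent ℝ f)
    (hι : Fintype.card ι = Module.finrank ℝ V) (hκ : Fintype.card κ = Module.finrank ℝ U) :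
    StrictHall fun i j => 0 < secondMoment y (e i ⊗ₜ[ℝ] f j) :=
  (hy.strictHall he hf hι hκ).mono fun _ _ h => secondMoment_pos (E := V ⊗[ℝ] U) h

theorem IsStableTuple.sub_sampleMean {m : ℕ} {x : Fin (m + 1) → V ⊗[ℝ] U}
    (hx : IsStableTuple fun k : Fin m => x k.succ - x 0) :
    IsStableTuple fun k => x k - sampleMean x := by
  refine fun W Z hW hZ horth => hx W Z hW hZ fun k => ?_
  have hsub := Submodule.sub_mem _ (horth k.succ) (horth 0)
  rwa [sub_sub_sub_cancel_right] at hsub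

variable [FiniteDimensional ℝ V] [FiniteDimensional ℝ U]

theorem gaussianNLL_eq_add (hn : n ≠ 0) (x : Fin n → V ⊗[ℝ] U) (M : V ⊗[ℝ] U)
    (Θ : kroneckerCone V U) :
    gaussianNLL x (M, Θ) = gaussianNLL x (sampleMean x, Θ) +
      inner ℝ ((Θ : V ⊗[ℝ] U →L[ℝ] V ⊗[ℝ] U) (sampleMean x - M)) (sampleMean x - M) := by
  have h := mean_inner_sub_eq_add hn (kroneckerCone_subset_posDefOperators Θ.2).1 x M
  simp only [gaussianNLL, h, add_sub_right_comm]

theorem continuous_gaussianNLL (x : Fin n → V ⊗[ℝ] U) : Continuous (gaussianNLL x) :=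
  continuous_mean_inner_sub_log_det (E := V ⊗[ℝ] U) kroneckerCone_subset_posDefOperators x

theorem IsStableTuple.exists_pos_forall_orthonormal_strictHall {y : Fin n → V ⊗[ℝ] U}
    (hy : IsStableTuple y) (hι : Fintype.card ι = Module.finrank ℝ V)
    (hκ : Fintype.card κ = Module.finrank ℝ U) :
    ∃ δ > 0, ∀ (e : ι → V) (f : κ → U), Orthonormal ℝ e → Orthonormal ℝ f →
      StrictHall fun i j => δ ≤ secondMoment y (e i ⊗ₜ[ℝ] f j) := by
  have hcont (i : ι) (j : κ) : Continuous fun z : (ι → V) × (κ → U) =>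
      secondMoment y (z.1 i ⊗ₜ[ℝ] z.2 j) :=
    (continuous_secondMoment y).comp (continuous_tmul_apply i j)
  obtain ⟨δ, hδ, h⟩ := exists_pos_forall_strictHall_le
    (isCompact_setOf_orthonormal.prod isCompact_setOf_orthonormal) hcont
    fun z hz => hy.strictHall_secondMoment_pos hz.1.linearIndependent hz.2.linearIndependent hι hκ
  exact ⟨δ, hδ, fun e f he hf => h (e, f) ⟨he, hf⟩⟩

variable [Nontrivial V] [Nontrivial U]

theorem exists_isCompact_forall_gaussianNLL_le_mem (hn : n ≠ 0) {x : Fin n → V ⊗[ℝ] U}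
    (hx : IsStableTuple fun k => x k - sampleMean x) (A : ℝ) :
    ∃ K : Set ((V ⊗[ℝ] U) × kroneckerCone V U), IsCompact K ∧
      ∀ s, gaussianNLL x s ≤ A → s ∈ K := by
  set ι := Fin (Module.finrank ℝ V)
  set κ := Fin (Module.finrank ℝ U)
  have : Nonempty ι := Fin.pos_iff_nonempty.1 Module.finrank_pos
  have : Nonempty κ := Fin.pos_iff_nonempty.1 Module.finrank_pos
  obtain ⟨δ, hδ, hHall⟩ := hx.exists_pos_forall_orthonormal_strictHall (ι := ι) (κ := κ)
    (Fintype.card_fin _) (Fintype.card_fin _)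
  obtain ⟨C, hC⟩ := exists_forall_abs_add_le_of_separableEnergy_le ι κ hδ A
  set L : ℝ := Fintype.card (ι × κ) * (1 + Real.log (δ / Fintype.card (ι × κ)))
  refine ⟨_, (isCompact_closedBall (sampleMean x) √((A - L) * Real.exp C)).prod
    (isCompact_setOf_kroneckerDiag (ι := ι) (κ := κ) (Fintype.card_fin _) (Fintype.card_fin _)
      (2 * C)), ?_⟩
  rintro ⟨M, Θ⟩ hA
  obtain ⟨v, u, a, b, hΘ⟩ := exists_eq_kroneckerDiag Θ.2
  have hadd := gaussianNLL_eq_add hn x M Θ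
  rw [gaussianNLL_eq_of_orthonormalBasis x (sampleMean x) v u a b hΘ] at hadd
  have hquad := inner_nonneg_of_mem_posDefOperators (kroneckerCone_subset_posDefOperators Θ.2)
    (sampleMean x - M)
  have hlow := card_mul_le_separableEnergy_of_strictHall (fun i j => secondMoment_nonneg _ _) hδ
    (hHall v u v.orthonormal u.orthonormal) a b
  have hab := hC _ (fun i j => secondMoment_nonneg _ _) (hHall v u v.orthonormal u.orthonormal)
    a b (by linarith)
  refine ⟨?mean, ?covariance⟩
  case mean =>
    have hcoer : Real.exp (-C) * ‖sampleMean x - M‖ ^ 2 ≤ A - L := by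
      have := mul_sq_norm_le_inner_diagOp (v.tensorProduct u)
        (fun z => Real.exp_le_exp.2 (abs_le.1 (hab z.1 z.2)).1) (sampleMean x - M)
      rw [← kroneckerDiag_orthonormalBasis, ← hΘ] at this
      linarith
    rw [Real.exp_neg, inv_mul_le_iff₀ (Real.exp_pos _), mul_comm] at hcoer
    exact mem_closedBall_iff_norm'.2 (Real.le_sqrt_of_sq_le hcoer)
  case covariance =>
    obtain ⟨a', b', heq, hnorm⟩ := exists_norm_le_of_abs_add_le hab
    exact ⟨v, u, a', b', v.orthonormal, u.orthonormal, hnorm,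
      hΘ.trans (kroneckerDiag_congr v u heq).symm⟩

end Likelihood

section Minimizer

theorem continuous_extendByTop {S : Type*} [TopologicalSpace S] [T2Space S] {f : S → ℝ}
    (hf : Continuous f) (hlim : Filter.Tendsto f (Filter.cocompact S) Filter.atTop) :
    Continuous (extendByTop f) := by
  rw [continuous_iff_continuousAt]
  intro z
  induction z using OnePoint.rec with
  | infty =>
    rw [OnePoint.continuousAt_infty', Filter.coclosedCompact_eq_cocompact]
    exact EReal.tendsto_coe_nhds_top_iff.2 hlim
  | coe s =>
    rw [OnePoint.continuousAt_coe]
    exact (continuous_coe_real_ereal.comp hf).continuousAt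

variable {V U : Type*}
  [NormedAddCommGroup V] [InnerProductSpace ℝ V] [FiniteDimensional ℝ V]
  [NormedAddCommGroup U] [InnerProductSpace ℝ U] [FiniteDimensional ℝ U]
  {n : ℕ} {x : Fin n → V ⊗[ℝ] U}

theorem fst_eq_sampleMean_of_forall_gaussianNLL_le (hn : n ≠ 0)
    {s : (V ⊗[ℝ] U) × kroneckerCone V U} (hs : ∀ t, gaussianNLL x s ≤ gaussianNLL x t) :
    s.1 = sampleMean x := by
  by_contra hne
  have hpos := (kroneckerCone_subset_posDefOperators s.2.2).2 (sampleMean x - s.1)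
    (sub_ne_zero.2 (Ne.symm hne))
  linarith [hs (sampleMean x, s.2), gaussianNLL_eq_add hn x s.1 s.2]

variable [Nontrivial U]

theorem eq_of_forall_gaussianNLL_sampleMean_le
    (hx : IsStableTuple fun k => x k - sampleMean x) {Θ₁ Θ₂ : kroneckerCone V U}
    (h₁ : ∀ Θ, gaussianNLL x (sampleMean x, Θ₁) ≤ gaussianNLL x (sampleMean x, Θ))
    (h₂ : ∀ Θ, gaussianNLL x (sampleMean x, Θ₂) ≤ gaussianNLL x (sampleMean x, Θ)) :
    Θ₁ = Θ₂ := by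
  obtain ⟨e, f, a, b, hΘ₁, hΘ₂⟩ :=
    exists_basis_eq_kroneckerDiag_zero_and_eq_kroneckerDiag Θ₁.2 Θ₂.2
  have : Nonempty (Fin (Module.finrank ℝ U)) := Fin.pos_iff_nonempty.1 Module.finrank_pos
  have hHall := hx.strictHall_secondMoment_pos e.linearIndependent f.linearIndependent
    (Fintype.card_fin _) (Fintype.card_fin _)
  set c := fun i j => secondMoment (fun k => x k - sampleMean x) (e i ⊗ₜ[ℝ] f j)
  have hmin (a' b') : separableEnergy c 0 0 ≤ separableEnergy c a' b' := by
    have h := h₁ ⟨kroneckerDiag e f a' b', kroneckerDiag_mem_kroneckerCone e f a' b'⟩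
    rwa [gaussianNLL_eq_of_basis x _ e f 0 0 hΘ₁, gaussianNLL_eq_of_basis x _ e f a' b' rfl,
      sub_le_sub_iff_right] at h
  have hab : separableEnergy c a b ≤ separableEnergy c 0 0 := by
    have h := h₂ Θ₁
    rwa [gaussianNLL_eq_of_basis x _ e f 0 0 hΘ₁, gaussianNLL_eq_of_basis x _ e f a b hΘ₂,
      sub_le_sub_iff_right] at h
  have hzero := add_eq_zero_of_separableEnergy_le (fun i j => secondMoment_nonneg _ _) hHall hmin
    hab
  refine Subtype.ext (hΘ₁.trans (Eq.trans ?_ hΘ₂.symm))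
  exact kroneckerDiag_congr e f fun i j => (add_zero 0).trans (hzero i j).symm

theorem eq_of_forall_gaussianNLL_le (hn : n ≠ 0)
    (hx : IsStableTuple fun k => x k - sampleMean x) {s t : (V ⊗[ℝ] U) × kroneckerCone V U}
    (hs : ∀ r, gaussianNLL x s ≤ gaussianNLL x r) (ht : ∀ r, gaussianNLL x t ≤ gaussianNLL x r) :
    s = t := by
  obtain ⟨M, Θ₁⟩ := s
  obtain ⟨N, Θ₂⟩ := t
  obtain rfl : M = sampleMean x := fst_eq_sampleMean_of_forall_gaussianNLL_le hn hs
  obtain rfl : N = sampleMean x := fst_eq_sampleMean_of_forall_gaussianNLL_le hn ht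
  rw [eq_of_forall_gaussianNLL_sampleMean_le hx (fun Θ => hs (_, Θ)) fun Θ => ht (_, Θ)]

variable [Nontrivial V]

theorem tendsto_gaussianNLL_cocompact_atTop (hn : n ≠ 0)
    (hx : IsStableTuple fun k => x k - sampleMean x) :
    Filter.Tendsto (gaussianNLL x) (Filter.cocompact ((V ⊗[ℝ] U) × kroneckerCone V U))
      Filter.atTop := by
  refine Filter.tendsto_atTop.2 fun A => ?_
  obtain ⟨K, hK, hmem⟩ := exists_isCompact_forall_gaussianNLL_le_mem hn hx A
  filter_upwards [hK.compl_mem_cocompact] with s hs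
  exact le_of_not_ge fun hle => hs (hmem s hle)

theorem existsUnique_forall_gaussianNLL_le (hn : n ≠ 0)
    (hx : IsStableTuple fun k => x k - sampleMean x) :
    ∃! s : (V ⊗[ℝ] U) × kroneckerCone V U, ∀ t, gaussianNLL x s ≤ gaussianNLL x t := by
  have : Nonempty ((V ⊗[ℝ] U) × kroneckerCone V U) :=
    ⟨(0, ⟨_, kroneckerDiag_mem_kroneckerCone (stdOrthonormalBasis ℝ V).toBasis
      (stdOrthonormalBasis ℝ U).toBasis 0 0⟩)⟩
  obtain ⟨s, hs⟩ :=
    (continuous_gaussianNLL x).exists_forall_le (tendsto_gaussianNLL_cocompact_atTop hn hx)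
  exact ⟨s, hs, fun t ht => eq_of_forall_gaussianNLL_le hn hx ht hs⟩

end Minimizer

theorem mainTheorem4_general
    {V U : Type*}
    [NormedAddCommGroup V] [InnerProductSpace ℝ V] [FiniteDimensional ℝ V] [Nontrivial V]
    [NormedAddCommGroup U] [InnerProductSpace ℝ U] [FiniteDimensional ℝ U] [Nontrivial U]
    [MeasurableSpace (V ⊗[ℝ] U)] [BorelSpace (V ⊗[ℝ] U)]
    {Ω : Type*} [MeasurableSpace Ω] (μ : Measure Ω) (m : ℕ)
    (hm : (Module.finrank ℝ V : ℝ) / Module.finrank ℝ U +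
      (Module.finrank ℝ U : ℝ) / Module.finrank ℝ V < m)
    (X : Fin (m + 1) → Ω → V ⊗[ℝ] U)
    (hX : JointlyContinuous (fun (i : Fin m) ω => X i.succ ω - X 0 ω) μ) :
    ∀ᵐ ω ∂μ,
      Continuous (extendByTop (gaussianNLL fun i => X i ω)) ∧
      ∃! s : (V ⊗[ℝ] U) × kroneckerCone V U,
        ∀ t : (V ⊗[ℝ] U) × kroneckerCone V U,
          gaussianNLL (fun i => X i ω) s ≤ gaussianNLL (fun i => X i ω) t := by
  have hV : (0 : ℝ) < Module.finrank ℝ V := Nat.cast_pos.2 Module.finrank_pos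
  have hU : (0 : ℝ) < Module.finrank ℝ U := Nat.cast_pos.2 Module.finrank_pos
  have hcard : Module.finrank ℝ V ^ 2 + Module.finrank ℝ U ^ 2 <
      Fintype.card (Fin m) * (Module.finrank ℝ V * Module.finrank ℝ U) := by
    rw [div_add_div _ _ hU.ne' hV.ne', div_lt_iff₀ (mul_pos hU hV)] at hm
    rw [Fintype.card_fin, mul_comm (Module.finrank ℝ V), pow_two, pow_two]
    exact_mod_cast hm
  have hstable : ∀ᵐ ω ∂μ, IsStableTuple fun k : Fin m => X k.succ ω - X 0 ω :=
    ae_of_ae_map hX.1 (hX.2.ae_le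
      (ae_isStableTuple (volume : Measure (Fin m → V ⊗[ℝ] U)) hcard))
  filter_upwards [hstable] with ω hω
  have hdev : IsStableTuple fun k => X k ω - sampleMean fun i => X i ω :=
    IsStableTuple.sub_sampleMean hω
  exact ⟨continuous_extendByTop (continuous_gaussianNLL _)
      (tendsto_gaussianNLL_cocompact_atTop m.succ_ne_zero hdev),
    existsUnique_forall_gaussianNLL_le m.succ_ne_zero hdev⟩

theorem mainTheorem4
    {V U : Type*}
    [NormedAddCommGroup V] [InnerProductSpace ℝ V] [FiniteDimensional ℝ V] [Nontrivial V]
    [NormedAddCommGroup U] [InnerProductSpace ℝ U] [FiniteDimensional ℝ U] [Nontrivial U]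
    [MeasurableSpace (V ⊗[ℝ] U)] [BorelSpace (V ⊗[ℝ] U)]
    {Ω : Type*} [MeasurableSpace Ω] (μ : Measure Ω) [IsProbabilityMeasure μ]
    (p q n : ℕ) (hp : Module.finrank ℝ V = p) (hq : Module.finrank ℝ U = q)
    (hn : 1 + (p : ℝ) / q + (q : ℝ) / p < n)
    (X : Fin n → Ω → V ⊗[ℝ] U) (hX : JointlyContinuous X μ) :
    ∀ᵐ ω ∂μ,
      Continuous (extendByTop (gaussianNLL fun i => X i ω)) ∧
      ∃! s : (V ⊗[ℝ] U) × kroneckerCone V U,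
        ∀ t : (V ⊗[ℝ] U) × kroneckerCone V U,
          gaussianNLL (fun i => X i ω) s ≤ gaussianNLL (fun i => X i ω) t := by
  subst hp hq
  have hpos : 0 < n := Nat.cast_pos.1 (lt_of_le_of_lt (by positivity) hn)
  obtain ⟨m, rfl⟩ := Nat.exists_eq_succ_of_ne_zero hpos.ne'
  refine mainTheorem4_general μ m ?_ X hX.succ_sub_zero
  rw [Nat.cast_succ] at hn
  linarith
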